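/- Let $L\subset\mathbb{RP}^3$ be a projective line. Call planes through $L$ horizontal, and call a projective line non-horizontal if it does not meet $L$. Let $B\subset\mathbb{RP}^3$ be a (projective) convex-concave body with respect to $L$, that is, a non-empty closed set with $B\cap L=\emptyset$ such that (i) for every horizontal plane $N$ the section $B\cap N$ is convex (in the affine plane $N\setminus L$), and (ii) for any three distinct horizontal planes $N_1,N_2,N_3$, through every point of $B\cap N_1$ passes a projective line that meets both $B\cap N_2$ and $B\cap N_3$. Let $L_1,\dots,L_5$ be five distinct horizontal planes and $S_i=B\cap L_i$. Choose homogeneous coordinates $(\tilde x:\tilde y:\tilde z:\tilde w)$ such that $L=\{\tilde z=\tilde w=0\}$ and all $S_i$ lie in the affine chart $\{\tilde w\neq 0\}\cong\mathbb R^3$ with coordinates $(\tilde x/\tilde w,\tilde y/\tilde w,\tilde z/\tilde w)$, and measure distances by the standard Euclidean metric of this chart. Let $\ell$ be a Chebyshev line, that is, a non-horizontal line that minimizes $$\max_{i=1,\dots,5}\operatorname{dist}(\ell\cap L_i,S_i)$$ among all non-horizontal lines. Then $\ell$ meets each $L_i$ in exactly one point $a_i$ of the chart, there is a point $s_i\in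 S_i$ closest to $a_i$, and the five numbers $\operatorname{dist}(a_i,S_i)=\operatorname{dist}(a_i,s_i)$, $i=1,\dots,5$, are all equal. Consequently, if no projective line meets all five sections $S_1,\dots,S_5$, then $\ell$ meets none of them. -/

import Mathlib

open scoped LinearAlgebra.Projectivization

noncomputable section

namespace ChebyshevLine

/-- Homogeneous coordinate space of real projective 3-space. -/
abbrev V : Type := Fin 4 → ℝ

/-- Real projective 3-space. -/
abbrev RP3 : Type := ℙ ℝ V

/-- The affine space `ℝ³` with its standard scalar product. -/
abbrev E3 : Type := EuclideanSpace ℝ (Fin 3)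

/-- The projective subspace cut out by a linear subspace `M`, as a set of points. -/
def points (M : Submodule ℝ V) : Set RP3 := {p | p.submodule ≤ M}

/-- `M` represents a projective line. -/
def IsLine (M : Submodule ℝ V) : Prop := Module.finrank ℝ M = 2

/-- `N` represents a horizontal plane: a projective plane through the line `L`. -/
def IsHorizontalPlane (L N : Submodule ℝ V) : Prop := Module.finrank ℝ N = 3 ∧ L ≤ N

/-- `M` represents a non-horizontal line: a projective line that does not meet `L`. -/
def IsNonHorizontalLine (L M : Submodule ℝ V) : Prop :=
  IsLine M ∧ points M ∩ points L = ∅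

/-- The section of `B` by the plane `N`. -/
def planeSection (B : Set RP3) (N : Submodule ℝ V) : Set RP3 := B ∩ points N

/-- Closedness for the quotient topology of `RP3 = (V \ {0}) / ℝˣ`. -/
def IsClosedProj (B : Set RP3) : Prop :=
  IsClosed {v : {v : V // v ≠ 0} | Projectivization.mk ℝ v.1 v.2 ∈ B}

/-- Convexity of a set `S` of points of the plane `N` in the affine plane `N \ L`. A linear
functional `f` whose zero set in `N` is `L` identifies `N \ L` with the affine plane
`{v ∈ N | f v = 1}`; on `N` such an `f` is unique up to a nonzero factor. -/
def IsConvexOff (L N : Submodule ℝ V) (S : Set RP3) : Prop :=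
  ∀ f : V →ₗ[ℝ] ℝ, N ⊓ LinearMap.ker f = L →
    Convex ℝ {v : V | v ∈ N ∧ f v = 1 ∧ ∃ hv : v ≠ 0, Projectivization.mk ℝ v hv ∈ S}

/-- Projective convex-concave bodies with respect to the infinite line `L`. -/
structure IsConvexConcave (L : Submodule ℝ V) (B : Set RP3) : Prop where
  isLine : IsLine L
  nonempty : B.Nonempty
  closed : IsClosedProj B
  disjoint : B ∩ points L = ∅
  convex : ∀ N, IsHorizontalPlane L N → IsConvexOff L N (planeSection B N)
  concave : ∀ N₁ N₂ N₃, IsHorizontalPlane L N₁ → IsHorizontalPlane L N₂ →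
    IsHorizontalPlane L N₃ → N₁ ≠ N₂ → N₁ ≠ N₃ → N₂ ≠ N₃ →
    ∀ p ∈ planeSection B N₁, ∃ M, IsLine M ∧ p ∈ points M ∧
      (points M ∩ planeSection B N₂).Nonempty ∧ (points M ∩ planeSection B N₃).Nonempty

/-- The point `[x : y : z : 1]` in the homogeneous coordinates `e`. -/
def ofAffine (e : V ≃ₗ[ℝ] V) (q : E3) : RP3 :=
  Projectivization.mk ℝ (e.symm ![q 0, q 1, q 2, 1]) (by
    intro h
    have h' : (![q 0, q 1, q 2, 1] : V) = 0 := (LinearEquiv.map_eq_zero_iff e.symm).mp h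
    have h3 := congrFun h' 3
    simp at h3)

/-- The part of `A` in the affine chart `w ≠ 0` of the coordinates `e = (x, y, z, w)`,
as a subset of `ℝ³`. -/
def affinePart (e : V ≃ₗ[ℝ] V) (A : Set RP3) : Set E3 := {q | ofAffine e q ∈ A}

/-- The distance between two sets, `inf {|p - q| : p ∈ A, q ∈ C}`. -/
def setDist (A C : Set E3) : ℝ := sInf (Set.image2 dist A C)

/-- The distance, in the plane `N`, from the point where `M` meets `N` to the section of `B`. -/
def distToSection (e : V ≃ₗ[ℝ] V) (B : Set RP3) (M N : Submodule ℝ V) : ℝ :=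
  setDist (affinePart e (points M ∩ points N)) (affinePart e (planeSection B N))

/-- `M` minimizes the maximal distance to the five sections among non-horizontal lines. -/
def IsChebyshevLine (L : Submodule ℝ V) (e : V ≃ₗ[ℝ] V) (B : Set RP3)
    (P : Fin 5 → Submodule ℝ V) (M : Submodule ℝ V) : Prop :=
  IsNonHorizontalLine L M ∧ ∀ M', IsNonHorizontalLine L M' →
    (⨆ i, distToSection e B M (P i)) ≤ ⨆ i, distToSection e B M' (P i)

end ChebyshevLine

end

/-!
A convex-concave body meets every plane at a fixed height in a non-empty compact convex set, and a
non-horizontal line is an affine map from heights to points of the chart. The distance from such a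
line to a section is then a convex function on the affine space of lines.

For each `i` some line meets the other four sections `A`, `B`, `C`, `D`. Identify a line with its
pair of intersection points in `A × B`. The lines which also meet `C`, respectively `D`, form
compact convex subsets of `A × B`; by concavity the first projects onto `A` and the second onto
`B`. Two such sets cannot be separated by a hyperplane: a separating functional would increase
without end along a zigzag of steps parallel to the two factors. A common point is the required
line.

Moving a minimizer slightly towards the line found for `i` decreases every positive distance except
possibly the `i`-th, so the maximum could be lowered if the `i`-th distance were smaller than it.
-/

namespace ChebyshevLine

section ConvexSets

theorem inter_nonempty_of_fst_image_subset_of_snd_image_subset {F G : Type*}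
    [AddCommGroup F] [Module ℝ F] [TopologicalSpace F] [IsTopologicalAddGroup F]
    [ContinuousSMul ℝ F] [LocallyConvexSpace ℝ F]
    [AddCommGroup G] [Module ℝ G] [TopologicalSpace G] [IsTopologicalAddGroup G]
    [ContinuousSMul ℝ G] [LocallyConvexSpace ℝ G] {A C : Set (F × G)}
    (hA : IsCompact A) (hAconv : Convex ℝ A) (hAne : A.Nonempty)
    (hC : IsClosed C) (hCconv : Convex ℝ C)
    (hfst : Prod.fst '' C ⊆ Prod.fst '' A) (hsnd : Prod.snd '' A ⊆ Prod.snd '' C) :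
    (A ∩ C).Nonempty := by
  by_contra hempty
  obtain ⟨φ, u, v, hφA, huv, hφC⟩ := geometric_hahn_banach_compact_closed hAconv hA hCconv hC
    (Set.disjoint_iff_inter_eq_empty.mpr (Set.not_nonempty_iff_eq_empty.mp hempty))
  have hsplit : ∀ z : F × G, φ z = φ (z.1, 0) + φ (0, z.2) := fun z => by
    rw [← map_add, Prod.mk_add_mk, add_zero, zero_add]
  -- A step from `A` to `C` along the first factor, then back to `A` along the second, increases
  -- `φ (·, 0)`, which is bounded on the compact set `A`.
  obtain ⟨a, ha, hmax⟩ := hA.exists_isMaxOn hAne (f := fun z => φ (z.1, 0)) (by fun_prop)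
  obtain ⟨c, hc, hca⟩ := hsnd ⟨a, ha, rfl⟩
  obtain ⟨a', ha', ha'c⟩ := hfst ⟨c, hc, rfl⟩
  have hle : φ (a'.1, 0) ≤ φ (a.1, 0) := hmax ha'
  have hlt : φ a < φ c := ((hφA a ha).trans huv).trans (hφC c hc)
  rw [hsplit a, hsplit c, hca, ← ha'c] at hlt
  linarith

theorem convexOn_infDist {E : Type*} [SeminormedAddCommGroup E] [NormedSpace ℝ E] {K : Set E}
    (hK : Convex ℝ K) (hne : K.Nonempty) :
    ConvexOn ℝ Set.univ fun x => Metric.infDist x K := by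
  refine ⟨convex_univ, fun x _ y _ a b ha hb hab => le_of_forall_pos_le_add fun ε hε => ?_⟩
  obtain ⟨p, hp, hxp⟩ := (Metric.infDist_lt_iff hne).mp
    (lt_add_of_pos_right (Metric.infDist x K) hε)
  obtain ⟨q, hq, hyq⟩ := (Metric.infDist_lt_iff hne).mp
    (lt_add_of_pos_right (Metric.infDist y K) hε)
  calc Metric.infDist (a • x + b • y) K
      ≤ dist (a • x + b • y) (a • p + b • q) :=
        Metric.infDist_le_dist_of_mem (hK hp hq ha hb hab)
    _ ≤ dist (a • x) (a • p) + dist (b • y) (b • q) := dist_add_add_le ..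
    _ = a * dist x p + b * dist y q := by
        rw [dist_smul₀, dist_smul₀, Real.norm_of_nonneg ha, Real.norm_of_nonneg hb]
    _ ≤ a * (Metric.infDist x K + ε) + b * (Metric.infDist y K + ε) := by gcongr
    _ = a • Metric.infDist x K + b • Metric.infDist y K + ε := by
        simp only [smul_eq_mul]
        linear_combination ε * hab

theorem eq_iSup_of_isMinOn_iSup {ι X : Type*} [Finite ι] [AddCommGroup X] [Module ℝ X]
    {Λ : Set X} {f : ι → X → ℝ} (hf : ∀ i, ConvexOn ℝ Λ (f i))
    (hnonpos : ∀ i, ∃ x ∈ Λ, ∀ j, j ≠ i → f j x ≤ 0) {m : X} (hm : m ∈ Λ)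
    (hnonneg : ∀ i, 0 ≤ f i m) (hmin : IsMinOn (fun x => ⨆ i, f i x) Λ m) (i : ι) :
    f i m = ⨆ j, f j m := by
  have hle : ∀ j, f j m ≤ ⨆ j, f j m :=
    le_ciSup (f := fun j => f j m) (Set.finite_range _).bddAbove
  refine (hle i).antisymm (not_lt.mp fun hlt => ?_)
  obtain ⟨x, hx, hxf⟩ := hnonpos i
  -- Moving slightly from `m` towards `x` keeps `f i` below the maximum and decreases every other
  -- `f j`.
  have hnear : ∀ᶠ ε in nhdsWithin (0 : ℝ) (Set.Ioi 0),
      (1 - ε) * f i m + ε * f i x < ⨆ j, f j m :=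
    (ContinuousAt.eventually_lt (by fun_prop) continuousAt_const (by simpa using hlt)).filter_mono
      nhdsWithin_le_nhds
  obtain ⟨ε, hεi, hε0, hε1⟩ := (hnear.and (Ioo_mem_nhdsGT zero_lt_one)).exists
  have hconv : ∀ j, f j ((1 - ε) • m + ε • x) ≤ (1 - ε) * f j m + ε * f j x := fun j =>
    (hf j).2 hm hx (sub_nonneg.mpr hε1.le) hε0.le (sub_add_cancel 1 ε)
  have hmem : (1 - ε) • m + ε • x ∈ Λ :=
    (hf i).1 hm hx (sub_nonneg.mpr hε1.le) hε0.le (sub_add_cancel 1 ε)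
  have : Nonempty ι := ⟨i⟩
  obtain ⟨j, hj⟩ := exists_eq_ciSup_of_finite (f := fun j => f j ((1 - ε) • m + ε • x))
  have hmin_le : ⨆ j, f j m ≤ f j ((1 - ε) • m + ε • x) := (hmin hmem).trans_eq hj.symm
  rcases eq_or_ne j i with rfl | hji
  · exact (hmin_le.trans (hconv j)).not_gt hεi
  · have hpos : 0 < ⨆ j, f j m := (hnonneg i).trans_lt hlt
    have hlt_max : f j ((1 - ε) • m + ε • x) < ⨆ j, f j m :=
      calc f j ((1 - ε) • m + ε • x)
          ≤ (1 - ε) * f j m + ε * f j x := hconv j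
        _ ≤ (1 - ε) * f j m := add_le_of_nonpos_right
            (mul_nonpos_of_nonneg_of_nonpos hε0.le (hxf j hji))
        _ ≤ (1 - ε) * ⨆ j, f j m := mul_le_mul_of_nonneg_left (hle j) (sub_nonneg.mpr hε1.le)
        _ < ⨆ j, f j m := mul_lt_of_lt_one_left hpos (sub_lt_self 1 hε0)
    exact hmin_le.not_gt hlt_max

end ConvexSets

section AffineLines

variable {E : Type*} [AddCommGroup E] [Module ℝ E]

theorem affineMap_apply_eq_lineMap {s t : ℝ} (hst : s ≠ t) (x : ℝ →ᵃ[ℝ] E) (u : ℝ) :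
    x u = AffineMap.lineMap (x s) (x t) ((u - s) / (t - s)) := by
  have hts : t - s ≠ 0 := sub_ne_zero.mpr hst.symm
  rw [← x.apply_lineMap, AffineMap.lineMap_apply_ring', div_mul_cancel₀ _ hts, sub_add_cancel]

/-- The affine map `ℝ → E` with value `p` at `s` and `q` at `t`, when `s ≠ t`. -/
noncomputable def lineThrough (s t : ℝ) (p q : E) : ℝ →ᵃ[ℝ] E :=
  (AffineMap.lineMap p q).comp ((t - s)⁻¹ • (AffineMap.id ℝ ℝ - AffineMap.const ℝ ℝ s))

theorem lineThrough_apply (s t : ℝ) (p q : E) (u : ℝ) :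
    lineThrough s t p q u = AffineMap.lineMap p q ((u - s) / (t - s)) := by
  simp [lineThrough, div_eq_inv_mul]

@[simp]
theorem lineThrough_apply_left (s t : ℝ) (p q : E) : lineThrough s t p q s = p := by
  simp [lineThrough_apply]

theorem lineThrough_apply_right {s t : ℝ} (hst : s ≠ t) (p q : E) :
    lineThrough s t p q t = q := by
  rw [lineThrough_apply, div_self (sub_ne_zero.mpr hst.symm), AffineMap.lineMap_apply_one]

theorem lineThrough_apply_apply {s t : ℝ} (hst : s ≠ t) (x : ℝ →ᵃ[ℝ] E) :
    lineThrough s t (x s) (x t) = x := by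
  ext u
  rw [lineThrough_apply, ← affineMap_apply_eq_lineMap hst]

theorem convex_setOf_lineThrough_apply_mem (s t u : ℝ) {K : Set E} (hK : Convex ℝ K) :
    Convex ℝ {z : E × E | lineThrough s t z.1 z.2 u ∈ K} := by
  simp only [lineThrough_apply]
  exact hK.affine_preimage (AffineMap.lineMap AffineMap.fst AffineMap.snd ((u - s) / (t - s)))

variable [TopologicalSpace E] [IsTopologicalAddGroup E] [ContinuousSMul ℝ E]

theorem isClosed_setOf_lineThrough_apply_mem (s t u : ℝ) {K : Set E} (hK : IsClosed K) :
    IsClosed {z : E × E | lineThrough s t z.1 z.2 u ∈ K} := by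
  simp only [lineThrough_apply, AffineMap.lineMap_apply_module]
  exact hK.preimage (by fun_prop)

theorem exists_affineMap_mem_four [LocallyConvexSpace ℝ E] [T2Space E]
    {a b c d : ℝ} (hab : a ≠ b) {A B C D : Set E}
    (hA : IsCompact A) (hB : IsCompact B) (hC : IsClosed C) (hD : IsClosed D)
    (hAconv : Convex ℝ A) (hBconv : Convex ℝ B) (hCconv : Convex ℝ C) (hDconv : Convex ℝ D)
    (hAne : A.Nonempty)
    (hAline : ∀ p ∈ A, ∃ x : ℝ →ᵃ[ℝ] E, x a = p ∧ x b ∈ B ∧ x c ∈ C)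
    (hBline : ∀ q ∈ B, ∃ x : ℝ →ᵃ[ℝ] E, x b = q ∧ x a ∈ A ∧ x d ∈ D) :
    ∃ x : ℝ →ᵃ[ℝ] E, x a ∈ A ∧ x b ∈ B ∧ x c ∈ C ∧ x d ∈ D := by
  let linesMeeting (u : ℝ) (K : Set E) : Set (E × E) :=
    A ×ˢ B ∩ {z | lineThrough a b z.1 z.2 u ∈ K}
  have hline : ∀ p ∈ A, ∃ q, (p, q) ∈ linesMeeting c C := by
    intro p hp
    obtain ⟨x, rfl, hxB, hxC⟩ := hAline p hp
    exact ⟨x b, ⟨hp, hxB⟩, by simpa [lineThrough_apply_apply hab] using hxC⟩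
  have hfst : Prod.fst '' linesMeeting d D ⊆ Prod.fst '' linesMeeting c C := by
    rintro _ ⟨z, ⟨⟨hz, -⟩, -⟩, rfl⟩
    obtain ⟨q, hq⟩ := hline z.1 hz
    exact ⟨_, hq, rfl⟩
  have hsnd : Prod.snd '' linesMeeting c C ⊆ Prod.snd '' linesMeeting d D := by
    rintro _ ⟨z, ⟨⟨-, hz⟩, -⟩, rfl⟩
    obtain ⟨x, hxz, hxA, hxD⟩ := hBline z.2 hz
    refine ⟨(x a, x b), ⟨⟨hxA, hxz ▸ hz⟩, ?_⟩, hxz⟩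
    simpa [lineThrough_apply_apply hab] using hxD
  obtain ⟨p, hp⟩ := hAne
  obtain ⟨q, hq⟩ := hline p hp
  obtain ⟨z, ⟨⟨hzA, hzB⟩, hzC⟩, -, hzD⟩ :=
    inter_nonempty_of_fst_image_subset_of_snd_image_subset
      ((hA.prod hB).inter_right (isClosed_setOf_lineThrough_apply_mem a b c hC))
      ((hAconv.prod hBconv).inter (convex_setOf_lineThrough_apply_mem a b c hCconv))
      ⟨(p, q), hq⟩
      ((hA.isClosed.prod hB.isClosed).inter (isClosed_setOf_lineThrough_apply_mem a b d hD))
      ((hAconv.prod hBconv).inter (convex_setOf_lineThrough_apply_mem a b d hDconv)) hfst hsnd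
  exact ⟨lineThrough a b z.1 z.2, by rwa [lineThrough_apply_left],
    by rwa [lineThrough_apply_right hab], hzC, hzD⟩

end AffineLines

section Chart

variable (e : V ≃ₗ[ℝ] V)

/-- The affine map `q ↦ (q, 1)` in the homogeneous coordinates `e`, a lift of `ofAffine e`. -/
noncomputable def affineLift : E3 →ᵃ[ℝ] V where
  toFun q := e.symm ![q 0, q 1, q 2, 1]
  linear :=
    { toFun := fun d => e.symm ![d 0, d 1, d 2, 0]
      map_add' := fun d d' => by
        rw [← map_add]
        simp
      map_smul' := fun c d => by
        rw [← map_smul]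
        simp }
  map_vadd' q d := by
    rw [LinearMap.coe_mk, AddHom.coe_mk, vadd_eq_add, vadd_eq_add, ← map_add]
    simp

theorem apply_affineLift (q : E3) : e (affineLift e q) = ![q 0, q 1, q 2, 1] :=
  e.apply_symm_apply _

@[simp]
theorem apply_affineLift_two (q : E3) : e (affineLift e q) 2 = q 2 := by
  simp [apply_affineLift]

@[simp]
theorem apply_affineLift_three (q : E3) : e (affineLift e q) 3 = 1 := by
  simp [apply_affineLift]

theorem affineLift_ne_zero (q : E3) : affineLift e q ≠ 0 := fun h => by
  simpa [h] using apply_affineLift_three e q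

theorem ofAffine_eq_mk (q : E3) :
    ofAffine e q = Projectivization.mk ℝ (affineLift e q) (affineLift_ne_zero e q) := rfl

theorem mk_mem_points {v : V} (hv : v ≠ 0) (N : Submodule ℝ V) :
    Projectivization.mk ℝ v hv ∈ points N ↔ v ∈ N :=
  Submodule.span_singleton_le_iff_mem v N

theorem ofAffine_mem_points (q : E3) (N : Submodule ℝ V) :
    ofAffine e q ∈ points N ↔ affineLift e q ∈ N :=
  mk_mem_points _ N

/-- The affine coordinates `(x / w, y / w, z / w)` of a vector with homogeneous coordinates
`(x, y, z, w)`, `w ≠ 0`. -/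
noncomputable def chart (v : V) : E3 := (e v 3)⁻¹ • !₂[e v 0, e v 1, e v 2]

theorem chart_smul_affineLift {c : ℝ} (hc : c ≠ 0) (q : E3) :
    chart e (c • affineLift e q) = q := by
  ext i
  fin_cases i <;> simp [chart, apply_affineLift, hc]

theorem affineLift_injective : Function.Injective (affineLift e) :=
  Function.LeftInverse.injective (g := chart e) fun q => by
    simpa using chart_smul_affineLift e one_ne_zero q

theorem smul_affineLift_chart {v : V} (hv : e v 3 ≠ 0) :
    e v 3 • affineLift e (chart e v) = v := by
  apply e.injective
  rw [map_smul, apply_affineLift]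
  ext i
  fin_cases i <;> simp [chart, hv]

theorem mk_eq_ofAffine_iff {v : V} (hv : v ≠ 0) (q : E3) :
    Projectivization.mk ℝ v hv = ofAffine e q ↔ e v 3 ≠ 0 ∧ chart e v = q := by
  rw [ofAffine_eq_mk, Projectivization.mk_eq_mk_iff']
  constructor
  · rintro ⟨c, rfl⟩
    have hc : c ≠ 0 := (smul_ne_zero_iff.mp hv).1
    exact ⟨by simpa using hc, chart_smul_affineLift e hc q⟩
  · rintro ⟨h3, rfl⟩
    exact ⟨e v 3, smul_affineLift_chart e h3⟩

theorem continuousOn_chart : ContinuousOn (chart e) {v | e v 3 ≠ 0} := by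
  have hcoord : ∀ i, Continuous fun v => e v i := fun i =>
    (continuous_apply i).comp e.toLinearMap.continuous_of_finiteDimensional
  refine ((hcoord 3).continuousOn.inv₀ fun v hv => hv).smul (Continuous.continuousOn ?_)
  refine (PiLp.continuous_toLp 2 _).comp (continuous_pi fun i => ?_)
  fin_cases i
  exacts [hcoord 0, hcoord 1, hcoord 2]

theorem isClosedProj_points (N : Submodule ℝ V) : IsClosedProj (points N) := by
  simp only [IsClosedProj, mk_mem_points]
  exact N.closed_of_finiteDimensional.preimage continuous_subtype_val

theorem isCompact_affinePart {A : Set RP3} (hA : IsClosedProj A)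
    (hchart : A ⊆ Set.range (ofAffine e)) : IsCompact (affinePart e A) := by
  obtain ⟨T, hT, hTA⟩ := isClosed_induced_iff.mp hA
  have hmemT : ∀ v (hv : v ≠ 0), v ∈ T ↔ Projectivization.mk ℝ v hv ∈ A := fun v hv =>
    Set.ext_iff.mp hTA ⟨v, hv⟩
  have hne : ∀ v ∈ Metric.sphere (0 : V) 1, v ≠ 0 := fun v hv =>
    ne_zero_of_mem_unit_sphere ⟨v, hv⟩
  have hmk : ∀ v (hv : v ∈ Metric.sphere (0 : V) 1 ∩ T), e v 3 ≠ 0 ∧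
      Projectivization.mk ℝ v (hne v hv.1) = ofAffine e (chart e v) := by
    intro v hv
    obtain ⟨q, hq⟩ := hchart ((hmemT v (hne v hv.1)).mp hv.2)
    obtain ⟨h3, rfl⟩ := (mk_eq_ofAffine_iff e _ q).mp hq.symm
    exact ⟨h3, hq.symm⟩
  have hcompact : IsCompact (Metric.sphere (0 : V) 1 ∩ T) :=
    (isCompact_sphere 0 1).inter_right hT
  convert hcompact.image_of_continuousOn
    ((continuousOn_chart e).mono fun v hv => (hmk v hv).1) using 1
  ext q
  constructor
  · intro hq
    have hlift := affineLift_ne_zero e q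
    have hnorm : ‖affineLift e q‖⁻¹ ≠ 0 := inv_ne_zero (norm_ne_zero_iff.mpr hlift)
    have hchart := chart_smul_affineLift e hnorm q
    refine ⟨‖affineLift e q‖⁻¹ • affineLift e q, ⟨?_, ?_⟩, hchart⟩
    · simpa using norm_smul_inv_norm (𝕜 := ℝ) hlift
    · rw [hmemT _ (smul_ne_zero hnorm hlift),
        (mk_eq_ofAffine_iff e _ q).mpr ⟨by simpa using hlift, hchart⟩]
      exact hq
  · rintro ⟨v, hv, rfl⟩
    change ofAffine e (chart e v) ∈ A
    rw [← (hmk v hv).2]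
    exact (hmemT v _).mp hv.2

theorem setDist_singleton (a : E3) (K : Set E3) : setDist {a} K = Metric.infDist a K := by
  rw [setDist, Set.image2_singleton_left, Metric.infDist_eq_iInf, sInf_image']

end Chart

section HorizontalPlanes

theorem IsHorizontalPlane.eq_of_mem {L N N' : Submodule ℝ V} (hL : IsLine L)
    (hN : IsHorizontalPlane L N) (hN' : IsHorizontalPlane L N') {v : V} (hvL : v ∉ L)
    (hvN : v ∈ N) (hvN' : v ∈ N') : N = N' := by
  have hlt : L < N ⊓ N' :=
    lt_of_le_of_ne (le_inf hN.2 hN'.2) fun h => hvL (h.symm ▸ Submodule.mem_inf.mpr ⟨hvN, hvN'⟩)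
  have hrank : 3 ≤ Module.finrank ℝ ↥(N ⊓ N') :=
    (congrArg (· + 1) hL.symm).trans_le (Submodule.finrank_lt_finrank_of_lt hlt)
  exact (Submodule.eq_of_le_of_finrank_le inf_le_left (hN.1.trans_le hrank)).symm.trans
    (Submodule.eq_of_le_of_finrank_le inf_le_right (hN'.1.trans_le hrank))

variable (e : V ≃ₗ[ℝ] V)

/-- The plane with equation `d z = c w` in the homogeneous coordinates `e = (x, y, z, w)`. For
`d = 1` it is the plane at height `c` in the chart. -/
noncomputable def horizontalPlane (c d : ℝ) : Submodule ℝ V :=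
  LinearMap.ker ((d • LinearMap.proj 2 - c • LinearMap.proj 3 : V →ₗ[ℝ] ℝ) ∘ₗ e.toLinearMap)

variable {e}

theorem mem_horizontalPlane {c d : ℝ} {v : V} :
    v ∈ horizontalPlane e c d ↔ d * e v 2 = c * e v 3 := by
  simp [horizontalPlane, sub_eq_zero]

theorem affineLift_mem_horizontalPlane_one {q : E3} {t : ℝ} :
    affineLift e q ∈ horizontalPlane e t 1 ↔ q 2 = t := by
  simp [mem_horizontalPlane]

theorem finrank_horizontalPlane {c d : ℝ} (hcd : ¬(c = 0 ∧ d = 0)) :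
    Module.finrank ℝ (horizontalPlane e c d) = 3 := by
  have hne : (d • LinearMap.proj 2 - c • LinearMap.proj 3 : V →ₗ[ℝ] ℝ) ∘ₗ e.toLinearMap ≠ 0 := by
    intro h
    have hc := LinearMap.congr_fun h (e.symm (Pi.single 3 1))
    have hd := LinearMap.congr_fun h (e.symm (Pi.single 2 1))
    exact hcd ⟨by simpa using hc, by simpa using hd⟩
  have hker := Module.Dual.finrank_ker_add_one_of_ne_zero hne
  rw [Module.finrank_fin_fun] at hker
  exact Nat.add_right_cancel hker

theorem horizontalPlane_one_injective : Function.Injective fun t => horizontalPlane e t 1 := by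
  intro s t (hst : horizontalPlane e s 1 = horizontalPlane e t 1)
  have hmem : affineLift e !₂[0, 0, s] ∈ horizontalPlane e s 1 :=
    affineLift_mem_horizontalPlane_one.mpr (by simp)
  exact affineLift_mem_horizontalPlane_one.mp (hst ▸ hmem)

variable {L : Submodule ℝ V} (heL : ∀ v : V, v ∈ L ↔ e v 2 = 0 ∧ e v 3 = 0)
include heL

theorem isHorizontalPlane_horizontalPlane {c d : ℝ} (hcd : ¬(c = 0 ∧ d = 0)) :
    IsHorizontalPlane L (horizontalPlane e c d) := by
  refine ⟨finrank_horizontalPlane hcd, fun v hv => mem_horizontalPlane.mpr ?_⟩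
  obtain ⟨h2, h3⟩ := (heL v).mp hv
  rw [h2, h3, mul_zero, mul_zero]

theorem isHorizontalPlane_horizontalPlane_one (t : ℝ) :
    IsHorizontalPlane L (horizontalPlane e t 1) :=
  isHorizontalPlane_horizontalPlane heL fun h => one_ne_zero h.2

theorem affineLift_notMem (q : E3) : affineLift e q ∉ L := fun h => by
  simpa using ((heL _).mp h).2

theorem exists_isHorizontalPlane_ne_ne (N N' : Submodule ℝ V) :
    ∃ N'', IsHorizontalPlane L N'' ∧ N'' ≠ N ∧ N'' ≠ N' := by
  obtain ⟨_, ⟨t, rfl⟩, ht⟩ := (Set.infinite_range_of_injective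
    (horizontalPlane_one_injective (e := e))).exists_notMem_finite (Set.toFinite {N, N'})
  rw [Set.mem_insert_iff, Set.mem_singleton_iff, not_or] at ht
  exact ⟨_, isHorizontalPlane_horizontalPlane_one heL t, ht⟩

end HorizontalPlanes

section Lines

variable (e : V ≃ₗ[ℝ] V)

/-- The parametrized lines in the chart along which the parameter is the height. -/
def heightLines : Set (ℝ →ᵃ[ℝ] E3) := {x | ∀ t, x t 2 = t}

theorem convex_heightLines : Convex ℝ heightLines := by
  intro x hx y hy a b _ _ hab t
  rw [AffineMap.coe_add, AffineMap.coe_smul, AffineMap.coe_smul]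
  simp only [Pi.add_apply, Pi.smul_apply, PiLp.add_apply, PiLp.smul_apply, hx t, hy t]
  rw [← add_smul, hab, one_smul]

theorem mem_heightLines_of_ne {x : ℝ →ᵃ[ℝ] E3} {s t : ℝ} (hst : s ≠ t) (hs : x s 2 = s)
    (ht : x t 2 = t) : x ∈ heightLines := by
  intro u
  have hts : t - s ≠ 0 := sub_ne_zero.mpr hst.symm
  rw [affineMap_apply_eq_lineMap hst, AffineMap.lineMap_apply_module']
  simp [hs, ht, hts]

/-- The projective line through the points `x 0` and `x 1` of the chart. -/
noncomputable def projectiveLine (x : ℝ →ᵃ[ℝ] E3) : Submodule ℝ V :=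
  Submodule.span ℝ {affineLift e (x 0), affineLift e (x 1)}

variable {e} {x : ℝ →ᵃ[ℝ] E3} (hx : x ∈ heightLines)
include hx

theorem mem_projectiveLine {v : V} : v ∈ projectiveLine e x ↔
    (e v 3 - e v 2) • affineLift e (x 0) + e v 2 • affineLift e (x 1) = v := by
  rw [projectiveLine, Submodule.mem_span_pair]
  constructor
  · rintro ⟨a, b, rfl⟩
    simp [hx 0, hx 1]
  · exact fun h => ⟨_, _, h⟩

theorem affineLift_mem_projectiveLine {q : E3} :
    affineLift e q ∈ projectiveLine e x ↔ q = x (q 2) := by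
  rw [mem_projectiveLine hx, apply_affineLift_two, apply_affineLift_three,
    ← AffineMap.lineMap_apply_module, ← AffineMap.apply_lineMap, ← AffineMap.apply_lineMap,
    (affineLift_injective e).eq_iff, AffineMap.lineMap_apply_ring', sub_zero, mul_one, add_zero,
    eq_comm]

theorem isLine_projectiveLine : IsLine (projectiveLine e x) := by
  have hindep : LinearIndependent ℝ ![affineLift e (x 0), affineLift e (x 1)] := by
    rw [LinearIndependent.pair_iff]
    intro a b h
    have hb : b = 0 := by simpa [hx 0, hx 1] using congrFun (congrArg e h) 2
    have hab : a + b = 0 := by simpa using congrFun (congrArg e h) 3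
    exact ⟨by rwa [hb, add_zero] at hab, hb⟩
  have hrank := finrank_span_eq_card hindep
  rwa [Matrix.range_cons_cons_empty, Fintype.card_fin] at hrank

theorem IsLine.eq_projectiveLine {M : Submodule ℝ V} (hM : IsLine M) {s t : ℝ} (hst : s ≠ t)
    (hs : affineLift e (x s) ∈ M) (ht : affineLift e (x t) ∈ M) : M = projectiveLine e x := by
  have hmem : ∀ u, affineLift e (x u) ∈ M := by
    intro u
    rw [affineMap_apply_eq_lineMap hst, AffineMap.apply_lineMap, AffineMap.lineMap_apply_module]
    exact M.add_mem (M.smul_mem _ hs) (M.smul_mem _ ht)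
  refine (Submodule.eq_of_le_of_finrank_le (Submodule.span_le.mpr ?_) ?_).symm
  · rintro _ (rfl | rfl)
    exacts [hmem 0, hmem 1]
  · exact (hM.trans (isLine_projectiveLine hx).symm).le

theorem affinePart_projectiveLine_inter (t : ℝ) :
    affinePart e (points (projectiveLine e x) ∩ points (horizontalPlane e t 1)) = {x t} := by
  ext q
  change ofAffine e q ∈ points _ ∧ ofAffine e q ∈ points _ ↔ q = x t
  rw [ofAffine_mem_points, ofAffine_mem_points, affineLift_mem_projectiveLine hx,
    affineLift_mem_horizontalPlane_one]
  constructor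
  · rintro ⟨hq, rfl⟩
    exact hq
  · rintro rfl
    rw [hx t]
    exact ⟨rfl, rfl⟩

omit hx

theorem IsLine.exists_heightLine {M : Submodule ℝ V} (hM : IsLine M) {p q : E3}
    (hpq : p 2 ≠ q 2) (hp : affineLift e p ∈ M) (hq : affineLift e q ∈ M) :
    ∃ x ∈ heightLines, M = projectiveLine e x := by
  have hxp := lineThrough_apply_left (p 2) (q 2) p q
  have hxq := lineThrough_apply_right hpq p q
  have hx : lineThrough (p 2) (q 2) p q ∈ heightLines :=
    mem_heightLines_of_ne hpq (by rw [hxp]) (by rw [hxq])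
  exact ⟨_, hx, hM.eq_projectiveLine hx hpq (by rwa [hxp]) (by rwa [hxq])⟩

theorem notMem_of_inter_points_eq_empty {A : Set RP3} {N : Submodule ℝ V} (h : A ∩ points N = ∅)
    {v : V} (hv : v ≠ 0) (hvA : Projectivization.mk ℝ v hv ∈ A) : v ∉ N := fun hvN =>
  Set.eq_empty_iff_forall_notMem.mp h _ ⟨hvA, (mk_mem_points hv N).mpr hvN⟩

variable {L : Submodule ℝ V} (heL : ∀ v : V, v ∈ L ↔ e v 2 = 0 ∧ e v 3 = 0)
include heL

theorem isNonHorizontalLine_projectiveLine (hx : x ∈ heightLines) :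
    IsNonHorizontalLine L (projectiveLine e x) := by
  refine ⟨isLine_projectiveLine hx, Set.eq_empty_iff_forall_notMem.mpr fun p => ?_⟩
  induction p using Projectivization.ind with
  | h v hv =>
    rintro ⟨hvM, hvL⟩
    obtain ⟨h2, h3⟩ := (heL v).mp ((mk_mem_points hv L).mp hvL)
    refine hv ?_
    rw [← (mem_projectiveLine hx).mp ((mk_mem_points hv _).mp hvM), h2, h3]
    simp

theorem IsNonHorizontalLine.exists_affineLift_mem {M : Submodule ℝ V}
    (hM : IsNonHorizontalLine L M) (t : ℝ) : ∃ q : E3, q 2 = t ∧ affineLift e q ∈ M := by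
  let π : M →ₗ[ℝ] ℝ × ℝ :=
    (((LinearMap.proj 2).prod (LinearMap.proj 3)) ∘ₗ e.toLinearMap) ∘ₗ M.subtype
  have hπ : ∀ v : M, π v = (e v 2, e v 3) := fun _ => rfl
  have hinj : Function.Injective π := by
    refine (injective_iff_map_eq_zero π).mpr fun v hv => by_contra fun hv0 => ?_
    have hv0' : (v : V) ≠ 0 := mt Submodule.coe_eq_zero.mp hv0
    rw [hπ, Prod.mk_eq_zero, ← heL] at hv
    exact notMem_of_inter_points_eq_empty hM.2 hv0' ((mk_mem_points hv0' M).mpr v.2) hv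
  have hsurj : Function.Surjective π :=
    (LinearMap.injective_iff_surjective_of_finrank_eq_finrank
      (by rw [Module.finrank_prod, Module.finrank_self]; exact hM.1)).mp hinj
  obtain ⟨v, hv⟩ := hsurj (t, 1)
  obtain ⟨h2, h3⟩ : e v 2 = t ∧ e v 3 = 1 := Prod.mk.inj hv
  have hlift : affineLift e (chart e v) = v := by
    simpa [h3] using smul_affineLift_chart e (v := v) (h3 ▸ one_ne_zero)
  exact ⟨chart e v, by rw [← apply_affineLift_two e, hlift, h2], by rw [hlift]; exact v.2⟩

theorem IsNonHorizontalLine.exists_heightLine {M : Submodule ℝ V}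
    (hM : IsNonHorizontalLine L M) : ∃ x ∈ heightLines, M = projectiveLine e x := by
  obtain ⟨p, hp, hpM⟩ := hM.exists_affineLift_mem heL 0
  obtain ⟨q, hq, hqM⟩ := hM.exists_affineLift_mem heL 1
  exact hM.1.exists_heightLine (by rw [hp, hq]; exact zero_ne_one) hpM hqM

end Lines

section LevelSections

/-- The section of `B` at height `t` in the chart. -/
def levelSection (e : V ≃ₗ[ℝ] V) (B : Set RP3) (t : ℝ) : Set E3 :=
  affinePart e (planeSection B (horizontalPlane e t 1))

variable {e : V ≃ₗ[ℝ] V} {B : Set RP3}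

theorem apply_two_of_mem_levelSection {t : ℝ} {q : E3} (hq : q ∈ levelSection e B t) : q 2 = t :=
  affineLift_mem_horizontalPlane_one.mp ((ofAffine_mem_points e q _).mp hq.2)

theorem distToSection_projectiveLine {x : ℝ →ᵃ[ℝ] E3} (hx : x ∈ heightLines) (t : ℝ) :
    distToSection e B (projectiveLine e x) (horizontalPlane e t 1) =
      Metric.infDist (x t) (levelSection e B t) := by
  rw [distToSection, affinePart_projectiveLine_inter hx, setDist_singleton, levelSection]

variable {L : Submodule ℝ V} (heL : ∀ v : V, v ∈ L ↔ e v 2 = 0 ∧ e v 3 = 0)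
include heL

theorem planeSection_subset_range_ofAffine (hBL : B ∩ points L = ∅) (t : ℝ) :
    planeSection B (horizontalPlane e t 1) ⊆ Set.range (ofAffine e) := by
  intro p
  induction p using Projectivization.ind with
  | h v hv =>
    rintro ⟨hvB, hvN⟩
    have h2 : e v 2 = t * e v 3 := by
      simpa using mem_horizontalPlane.mp ((mk_mem_points hv _).mp hvN)
    have h3 : e v 3 ≠ 0 := fun h3 =>
      notMem_of_inter_points_eq_empty hBL hv hvB ((heL v).mpr ⟨by rw [h2, h3, mul_zero], h3⟩)
    exact ⟨chart e v, ((mk_eq_ofAffine_iff e hv _).mpr ⟨h3, rfl⟩).symm⟩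

theorem projectiveLine_inter_planeSection_nonempty_iff (hBL : B ∩ points L = ∅)
    {x : ℝ →ᵃ[ℝ] E3} (hx : x ∈ heightLines) (t : ℝ) :
    (points (projectiveLine e x) ∩ planeSection B (horizontalPlane e t 1)).Nonempty ↔
      x t ∈ levelSection e B t := by
  have hxt : x t ∈ affinePart e (points (projectiveLine e x) ∩ points (horizontalPlane e t 1)) :=
    (affinePart_projectiveLine_inter hx t).symm ▸ Set.mem_singleton _
  refine ⟨?_, fun h => ⟨ofAffine e (x t), hxt.1, h⟩⟩
  rintro ⟨p, hpM, hp⟩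
  obtain ⟨q, rfl⟩ := planeSection_subset_range_ofAffine heL hBL t hp
  have hq : q ∈ affinePart e (points (projectiveLine e x) ∩ points (horizontalPlane e t 1)) :=
    ⟨hpM, hp.2⟩
  rw [affinePart_projectiveLine_inter hx] at hq
  exact hq ▸ hp

theorem exists_injective_heights {ι : Type*} {P : ι → Submodule ℝ V} (hL : IsLine L)
    (hP : ∀ i, IsHorizontalPlane L (P i)) (hinj : Function.Injective P)
    (hchart : ∀ i, (affinePart e (points (P i))).Nonempty) :
    ∃ t : ι → ℝ, Function.Injective t ∧ P = fun i => horizontalPlane e (t i) 1 := by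
  choose q hq using hchart
  have hPq : P = fun i => horizontalPlane e (q i 2) 1 := funext fun i =>
    (hP i).eq_of_mem hL (isHorizontalPlane_horizontalPlane_one heL _) (affineLift_notMem heL (q i))
      ((ofAffine_mem_points e _ _).mp (hq i)) (affineLift_mem_horizontalPlane_one.mpr rfl)
  refine ⟨fun i => q i 2, fun i j hij => hinj ?_, hPq⟩
  rw [hPq]
  exact congrArg (horizontalPlane e · 1) hij

variable (hB : IsConvexConcave L B)
include hB

namespace IsConvexConcave

theorem isCompact_levelSection (t : ℝ) : IsCompact (levelSection e B t) :=
  isCompact_affinePart e (hB.closed.inter (isClosedProj_points _))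
    (planeSection_subset_range_ofAffine heL hB.disjoint t)

theorem convex_levelSection (t : ℝ) : Convex ℝ (levelSection e B t) := by
  let w : V →ₗ[ℝ] ℝ := LinearMap.proj 3 ∘ₗ e.toLinearMap
  have hw : ∀ v, w v = e v 3 := fun _ => rfl
  have hker : horizontalPlane e t 1 ⊓ LinearMap.ker w = L := by
    ext v
    rw [Submodule.mem_inf, mem_horizontalPlane, LinearMap.mem_ker, hw, heL, one_mul]
    exact and_congr_left fun h3 => by rw [h3, mul_zero]
  have hpreimage : levelSection e B t = affineLift e ⁻¹' {v | v ∈ horizontalPlane e t 1 ∧ w v = 1 ∧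
      ∃ hv : v ≠ 0, Projectivization.mk ℝ v hv ∈ planeSection B (horizontalPlane e t 1)} := by
    ext q
    constructor
    · exact fun hq => ⟨(ofAffine_mem_points e q _).mp hq.2, apply_affineLift_three e q,
        affineLift_ne_zero e q, hq⟩
    · exact fun ⟨_, _, _, hq⟩ => hq
  rw [hpreimage]
  exact (hB.convex _ (isHorizontalPlane_horizontalPlane_one heL t) w hker).affine_preimage
    (affineLift e)

theorem planeSection_nonempty {N : Submodule ℝ V} (hN : IsHorizontalPlane L N) :
    (planeSection B N).Nonempty := by
  obtain ⟨p, hp⟩ := hB.nonempty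
  induction p using Projectivization.ind with
  | h v hv =>
    have hN₁ := isHorizontalPlane_horizontalPlane heL
      (mt (heL v).mpr (notMem_of_inter_points_eq_empty hB.disjoint hv hp))
    have hpN₁ : Projectivization.mk ℝ v hv ∈
        planeSection B (horizontalPlane e (e v 2) (e v 3)) :=
      ⟨hp, (mk_mem_points hv _).mpr (mem_horizontalPlane.mpr (mul_comm _ _))⟩
    rcases eq_or_ne (horizontalPlane e (e v 2) (e v 3)) N with rfl | hne
    · exact ⟨_, hpN₁⟩
    · obtain ⟨N₂, hN₂, hne₁, hne₂⟩ :=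
        exists_isHorizontalPlane_ne_ne heL (horizontalPlane e (e v 2) (e v 3)) N
      obtain ⟨M, -, -, ⟨q, -, hq⟩, -⟩ :=
        hB.concave _ N N₂ hN₁ hN hN₂ hne hne₁.symm hne₂.symm _ hpN₁
      exact ⟨q, hq⟩

theorem levelSection_nonempty (t : ℝ) : (levelSection e B t).Nonempty := by
  obtain ⟨p, hp⟩ := hB.planeSection_nonempty heL (isHorizontalPlane_horizontalPlane_one heL t)
  obtain ⟨q, rfl⟩ := planeSection_subset_range_ofAffine heL hB.disjoint t hp
  exact ⟨q, hp⟩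

theorem exists_heightLine_through {s t u : ℝ} (hst : s ≠ t) (hsu : s ≠ u) (htu : t ≠ u) {p : E3}
    (hp : p ∈ levelSection e B s) :
    ∃ x : ℝ →ᵃ[ℝ] E3, x s = p ∧ x t ∈ levelSection e B t ∧ x u ∈ levelSection e B u := by
  have hplane := isHorizontalPlane_horizontalPlane_one heL
  have hne {r r' : ℝ} (h : r ≠ r') : horizontalPlane e r 1 ≠ horizontalPlane e r' 1 :=
    horizontalPlane_one_injective.ne h
  obtain ⟨M, hM, hpM, ht, hu⟩ := hB.concave _ _ _ (hplane s) (hplane t) (hplane u)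
    (hne hst) (hne hsu) (hne htu) _ hp
  have hps : p 2 = s := apply_two_of_mem_levelSection hp
  obtain ⟨x, hx, rfl⟩ : ∃ x ∈ heightLines, M = projectiveLine e x := by
    obtain ⟨r, hrM, hr⟩ := ht
    obtain ⟨q, rfl⟩ := planeSection_subset_range_ofAffine heL hB.disjoint t hr
    rw [ofAffine_mem_points] at hpM hrM
    exact hM.exists_heightLine (by rwa [hps, apply_two_of_mem_levelSection hr]) hpM hrM
  have hmeets := projectiveLine_inter_planeSection_nonempty_iff heL hB.disjoint hx
  rw [ofAffine_mem_points, affineLift_mem_projectiveLine hx, hps] at hpM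
  exact ⟨x, hpM.symm, (hmeets t).mp ht, (hmeets u).mp hu⟩

theorem exists_heightLine_four {a b c d : ℝ} (hab : a ≠ b) (hac : a ≠ c) (had : a ≠ d)
    (hbc : b ≠ c) (hbd : b ≠ d) :
    ∃ x ∈ heightLines, x a ∈ levelSection e B a ∧ x b ∈ levelSection e B b ∧
      x c ∈ levelSection e B c ∧ x d ∈ levelSection e B d := by
  have hcompact := hB.isCompact_levelSection heL
  have hconv := hB.convex_levelSection heL
  obtain ⟨x, ha, hb, hcd⟩ := exists_affineMap_mem_four hab (hcompact a) (hcompact b)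
    (hcompact c).isClosed (hcompact d).isClosed (hconv a) (hconv b) (hconv c) (hconv d)
    (hB.levelSection_nonempty heL a)
    (fun _ => hB.exists_heightLine_through heL hab hac hbc)
    (fun _ => hB.exists_heightLine_through heL hab.symm hbd had)
  exact ⟨x, mem_heightLines_of_ne hab (apply_two_of_mem_levelSection ha)
    (apply_two_of_mem_levelSection hb), ha, hb, hcd⟩

theorem exists_heightLine_of_ne {t : Fin 5 → ℝ} (ht : Function.Injective t) (i : Fin 5) :
    ∃ x ∈ heightLines, ∀ j, j ≠ i → x (t j) ∈ levelSection e B (t j) := by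
  have hcover : ∀ i j : Fin 5, j ≠ i → j = i + 1 ∨ j = i + 2 ∨ j = i + 3 ∨ j = i + 4 := by decide
  obtain ⟨h12, h13, h14, h23, h24⟩ : i + 1 ≠ i + 2 ∧ i + 1 ≠ i + 3 ∧ i + 1 ≠ i + 4 ∧
      i + 2 ≠ i + 3 ∧ i + 2 ≠ i + 4 := by
    simp only [ne_eq, add_right_inj]
    decide
  obtain ⟨x, hx, h1, h2, h3, h4⟩ := hB.exists_heightLine_four heL
    (ht.ne h12) (ht.ne h13) (ht.ne h14) (ht.ne h23) (ht.ne h24)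
  refine ⟨x, hx, fun j hj => ?_⟩
  obtain rfl | rfl | rfl | rfl := hcover i j hj
  all_goals assumption

theorem infDist_levelSection_eq_iSup {t : Fin 5 → ℝ} (ht : Function.Injective t)
    {m : ℝ →ᵃ[ℝ] E3} (hm : m ∈ heightLines)
    (hmin : IsMinOn (fun x : ℝ →ᵃ[ℝ] E3 => ⨆ i, Metric.infDist (x (t i)) (levelSection e B (t i)))
      heightLines m) (i : Fin 5) :
    Metric.infDist (m (t i)) (levelSection e B (t i)) =
      ⨆ j, Metric.infDist (m (t j)) (levelSection e B (t j)) := by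
  let evalAt (s : ℝ) : (ℝ →ᵃ[ℝ] E3) →ₗ[ℝ] E3 :=
    { toFun := fun x => x s, map_add' := fun _ _ => rfl, map_smul' := fun _ _ => rfl }
  refine eq_iSup_of_isMinOn_iSup
    (f := fun i (x : ℝ →ᵃ[ℝ] E3) => Metric.infDist (x (t i)) (levelSection e B (t i)))
    (fun j => ?_) (fun j => ?_) hm (fun j => Metric.infDist_nonneg) hmin i
  · exact ((convexOn_infDist (hB.convex_levelSection heL (t j))
      (hB.levelSection_nonempty heL (t j))).comp_linearMap (evalAt (t j))).subset
        (Set.subset_univ _) convex_heightLines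
  · obtain ⟨x, hx, hmem⟩ := hB.exists_heightLine_of_ne heL ht j
    exact ⟨x, hx, fun k hk => (Metric.infDist_zero_of_mem (hmem k hk)).le⟩

end IsConvexConcave

end LevelSections

end ChebyshevLine

open ChebyshevLine in
theorem mainTheorem6
    (L : Submodule ℝ V) (B : Set RP3) (hB : IsConvexConcave L B)
    (P : Fin 5 → Submodule ℝ V) (hP : ∀ i, IsHorizontalPlane L (P i))
    (hinj : Function.Injective P)
    (e : V ≃ₗ[ℝ] V) (heL : ∀ v : V, v ∈ L ↔ e v 2 = 0 ∧ e v 3 = 0)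
    (heS : ∀ i, planeSection B (P i) ⊆ Set.range (ofAffine e))
    (M : Submodule ℝ V) (hM : IsChebyshevLine L e B P M) :
    (∃ r : ℝ, ∀ i, distToSection e B M (P i) = r ∧
      ∃ a s : E3, affinePart e (points M ∩ points (P i)) = {a} ∧
        s ∈ affinePart e (planeSection B (P i)) ∧
        (∀ q ∈ affinePart e (planeSection B (P i)), dist a s ≤ dist a q) ∧
        dist a s = r) ∧
    ((¬ ∃ M' : Submodule ℝ V, IsLine M' ∧
        ∀ i, (points M' ∩ planeSection B (P i)).Nonempty) →
      ∀ i, points M ∩ planeSection B (P i) = ∅) := by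
  obtain ⟨t, ht, rfl⟩ := exists_injective_heights heL hB.isLine hP hinj fun i => by
    obtain ⟨p, hp⟩ := hB.planeSection_nonempty heL (hP i)
    obtain ⟨q, rfl⟩ := heS i hp
    exact ⟨q, hp.2⟩
  obtain ⟨m, hm, rfl⟩ := hM.1.exists_heightLine heL
  have hcompact := hB.isCompact_levelSection heL
  have hne := hB.levelSection_nonempty heL
  have hmeets := projectiveLine_inter_planeSection_nonempty_iff heL hB.disjoint hm
  have hmin : IsMinOn (fun x : ℝ →ᵃ[ℝ] E3 =>
      ⨆ i, Metric.infDist (x (t i)) (levelSection e B (t i))) heightLines m :=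
    isMinOn_iff.mpr fun x hx => by
      simpa only [distToSection_projectiveLine hm, distToSection_projectiveLine hx] using
        hM.2 _ (isNonHorizontalLine_projectiveLine heL hx)
  have heq := hB.infDist_levelSection_eq_iSup heL ht hm hmin
  refine ⟨⟨_, fun i => ⟨(distToSection_projectiveLine hm (t i)).trans (heq i), ?_⟩⟩,
    fun hno i => Set.not_nonempty_iff_eq_empty.mp fun hi => hno ⟨_, hM.1.1, fun j => ?_⟩⟩
  · obtain ⟨s, hs, hdist⟩ := (hcompact (t i)).exists_infDist_eq_dist (hne (t i)) (m (t i))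
    exact ⟨m (t i), s, affinePart_projectiveLine_inter hm (t i), hs,
      fun q hq => hdist ▸ Metric.infDist_le_dist_of_mem hq, hdist ▸ heq i⟩
  · have hzero : Metric.infDist (m (t j)) (levelSection e B (t j)) = 0 :=
      (heq j).trans ((heq i).symm.trans (Metric.infDist_zero_of_mem ((hmeets (t i)).mp hi)))
    exact (hmeets (t j)).mpr
      (((hcompact (t j)).isClosed.mem_iff_infDist_zero (hne (t j))).mpr hzero)
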